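/- Let $d\in\mathbb N$, $L\ge 0$, $M_\beta>0$, $M_l\in\mathbb R$, $\eta>0$ and $0<\delta<1$. There is $m_0$, depending only on $d,L,M_\beta,M_l,\eta,\delta$, such that the following holds. Let $\mathcal Z\subseteq\mathbb R^d$ be bounded and let $\mathcal D$ be a probability distribution on $\mathcal Z$. Let $\mathcal A$ be a learning algorithm that maps each finite training sample $S=(z_1,\dots,z_m)\in\mathcal Z^m$ to an element $\mathcal A_S$ of a function class $\mathcal F$, and let $l:\mathcal F\times\mathcal Z\to\mathbb R$ be a loss with $0\le l\le M_l$. For every $m$ let $(S,z)\mapsto l(\mathcal A_S,z)$ be measurable on $\mathcal Z^m\times\mathcal Z$. Suppose that $\mathcal A$ has locally elastic stability $\beta_m(\cdot,\cdot)$ with respect to $l$: for all $m\ge 2$, $S\in\mathcal Z^m$, $1\le i\le m$ and $z\in\mathcal Z$, $$\bigl|l(\mathcal A_S,z)-l(\mathcal A_{S^{\backslash i}},z)\bigr|\le\beta_m(z_i,z),$$ where $S^{\backslash i}$ is $S$ with its $i$-th entry removed. Suppose further that $\beta_m(z',z)=\beta(z',z)/m$ for all $m\ge2$ and $z',z\in\mathcal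 Z$, where $\beta:\mathcal Z\times\mathcal Z\to\mathbb R$ does not depend on $m$, satisfies $|\beta|\le M_\beta$, is $L$-Lipschitz in its first argument for each fixed value of the second, and is measurable in its second argument for each fixed value of the first. Write $$\Delta(\mathcal A_S)=\mathbb E_{z\sim\mathcal D}\,l(\mathcal A_S,z)-\frac1m\sum_{j=1}^m l(\mathcal A_S,z_j)$$ for the generalization gap. Then for every $m\ge m_0$, with probability at least $1-\delta$ over a sample $S=(z_1,\dots,z_m)$ of $m$ independent draws from $\mathcal D$, $$\Delta(\mathcal A_S)\le\frac{2\sup_{z'\in\mathcal Z}\mathbb E_{z}\beta(z',z)}{m}+2\Bigl(2\sup_{z'\in\mathcal Z}\mathbb E_{z}\beta(z',z)+\eta+M_l\Bigr)\sqrt{\frac{2\log(2/\delta)}{m}},$$ where $\mathbb E_z$ is over $z\sim\mathcal D$. Moreover, the right-hand side tends to $0$ as $m\to\infty$. -/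

import Mathlib

open MeasureTheory Filter Topology
open scoped NNReal

/-- A learning algorithm: for every sample size `n` it maps a training sample `S ∈ 𝒵ⁿ` to an
element `𝒜_S` of the function class `F`. -/
abbrev LearningAlgorithm (Z : Type*) (F : Type*) := (n : ℕ) → (Fin n → Z) → F

/-- Locally elastic stability `β_m(·,·)` of the algorithm `A` with respect to the loss `l`: for
every sample size `m = n + 1 ≥ 2`, every sample `S = (z₁, …, z_m)`, every index `i` and every `z`,
`|l(𝒜_S, z) - l(𝒜_{S∖i}, z)| ≤ β_m(z_i, z)`, where `S∖i` is `S` with its `i`-th entry removed. -/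
def LocallyElasticStable {Z F : Type*} (A : LearningAlgorithm Z F) (l : F → Z → ℝ)
    (βm : ℕ → Z → Z → ℝ) : Prop :=
  ∀ n : ℕ, 1 ≤ n → ∀ (S : Fin (n + 1) → Z) (i : Fin (n + 1)) (z : Z),
    |l (A (n + 1) S) z - l (A n (i.removeNth S)) z| ≤ βm (n + 1) (S i) z

/-- The defect (generalization gap) `Δ(𝒜_S) = 𝔼_z l(𝒜_S, z) - (1/m) ∑ⱼ l(𝒜_S, zⱼ)`. -/
noncomputable def defect {Z F : Type*} [MeasurableSpace Z] (D : Measure Z)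
    (A : LearningAlgorithm Z F) (l : F → Z → ℝ) (m : ℕ) (S : Fin m → Z) : ℝ :=
  (∫ z, l (A m S) z ∂D) - (∑ j : Fin m, l (A m S) (S j)) / m

/-- The averaged sensitivity `sup_{z'} 𝔼_z β(z', z)`. -/
noncomputable def avgSensitivity {Z : Type*} [MeasurableSpace Z] (D : Measure Z)
    (β : Z → Z → ℝ) : ℝ :=
  ⨆ z' : Z, ∫ z, β z' z ∂D

/-- The bound `2σ/m + 2(2σ + η + M_l) √(2 log(2/δ)/m)` on the defect. -/
noncomputable def defectBound (σ η Ml δ : ℝ) (m : ℕ) : ℝ :=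
  2 * σ / m + 2 * (2 * σ + η + Ml) * Real.sqrt (2 * Real.log (2 / δ) / m)

/-! ### Integration and measurability on finite product measures -/

section ProductMeasure

variable {Z X : Type*} [MeasurableSpace Z] [MeasurableSpace X]

/-! Let `f` be the generalization gap as a function of `m` independent draws and let `σ` be
`avgSensitivity D β`. Exchanging `z_j` for a fresh draw shows that the mean of `f` is at most `(σ +
M)/m` (`integral_defect_le`). It remains to control the fluctuation of `f`.

A bounded-difference inequality with the worst-case increment `(4M + M_l)/m` would put `M` where the
bound asks for `σ`. But an increment at coordinate `k` is at most `(4σ + M_l)/m` plus `1/m` times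
deviations of leave-one-out averages of `β` from their means (`abs_defect_sub_update_le_dev`). Those
deviations do not see the coordinate `k`, and their second moment is `O(1/m)`
(`integral_sq_leaveOneOutDev_le`). So increments above the level `b = (4σ + M_l + τ)/m` are rare:
the mean excess of their squares over `b²` is `O(m⁻³)` (`integral_defect_excess_le`).

Rare large increments are absorbed by a Freedman-type argument. The exponential supermartingale
built on the predictable quadratic variation (`integral_exp_sub_quadVar_le_one`) needs the
worst-case increment only through `t * B ≤ 1`. The variation itself stays below `m b²/2 + s` except
with probability `O(1/m)` when `s` is of order `1/m`, by Markov's inequality and Jensen's inequality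
(`integral_quadVar_excess_le`). Optimizing `t` leaves `δ/2` for the exponential term and, for large
`m`, at most `δ/2` for the exceptional event. -/

@[fun_prop]
theorem Measurable.finInsertNth {n : ℕ} (j : Fin (n + 1)) {f : X → Z} {g : X → Fin n → Z}
    (hf : Measurable f) (hg : Measurable g) :
    Measurable (fun x => (j.insertNth (f x) (g x) : Fin (n + 1) → Z)) :=
  (MeasurableEquiv.piFinSuccAbove (fun _ : Fin (n + 1) => Z) j).symm.measurable.comp
    (hf.prodMk hg)

@[fun_prop]
theorem Measurable.finCons {n : ℕ} {f : X → Z} {g : X → Fin n → Z}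
    (hf : Measurable f) (hg : Measurable g) :
    Measurable (fun x => (Fin.cons (f x) (g x) : Fin (n + 1) → Z)) := by
  simpa only [Fin.insertNth_zero'] using hf.finInsertNth 0 hg

@[fun_prop]
theorem Measurable.finTail {n : ℕ} {g : X → Fin (n + 1) → Z} (hg : Measurable g) :
    Measurable (fun x => Fin.tail (g x)) := by
  unfold Fin.tail
  fun_prop

theorem integrable_of_abs_le {μ : Measure X} [IsFiniteMeasure μ] {f : X → ℝ}
    (hf : Measurable f) {K : ℝ} (hK : ∀ x, |f x| ≤ K) : Integrable f μ :=
  Integrable.of_bound hf.aestronglyMeasurable K (ae_of_all _ hK)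

theorem abs_integral_le_of_abs_le {μ : Measure X} [IsProbabilityMeasure μ] {f : X → ℝ}
    {K : ℝ} (hK : ∀ x, |f x| ≤ K) : |∫ x, f x ∂μ| ≤ K := by
  simpa using norm_integral_le_of_norm_le_const (μ := μ) (f := f) (C := K) (ae_of_all _ hK)

theorem integral_le_of_le {μ : Measure X} [IsProbabilityMeasure μ] {f : X → ℝ}
    (hf : Integrable f μ) {K : ℝ} (hK : ∀ x, f x ≤ K) : ∫ x, f x ∂μ ≤ K := by
  simpa using integral_mono hf (integrable_const K) hK

theorem Measurable.integral_right {μ : Measure Z} [SFinite μ] {f : X → Z → ℝ}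
    (hf : Measurable (Function.uncurry f)) : Measurable fun x => ∫ z, f x z ∂μ :=
  (StronglyMeasurable.integral_prod_right hf.stronglyMeasurable).measurable

variable (D : Measure Z) [IsProbabilityMeasure D]

theorem integral_pi_insertNth {n : ℕ} (j : Fin (n + 1)) {f : (Fin (n + 1) → Z) → ℝ}
    (hf : Measurable f) {K : ℝ} (hK : ∀ S, |f S| ≤ K) :
    ∫ S, f S ∂Measure.pi (fun _ : Fin (n + 1) => D) =
      ∫ z, ∫ S, f (j.insertNth z S) ∂Measure.pi (fun _ : Fin n => D) ∂D := by
  have h := (measurePreserving_piFinSuccAbove (fun _ : Fin (n + 1) => D) j).symm.integral_comp' f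
  rw [← h, integral_prod]
  · rfl
  · exact integrable_of_abs_le (hf.comp (MeasurableEquiv.measurable _)) fun x => hK _

theorem integral_pi_cons {n : ℕ} {f : (Fin (n + 1) → Z) → ℝ}
    (hf : Measurable f) {K : ℝ} (hK : ∀ S, |f S| ≤ K) :
    ∫ S, f S ∂Measure.pi (fun _ : Fin (n + 1) => D) =
      ∫ z, ∫ S, f (Fin.cons z S) ∂Measure.pi (fun _ : Fin n => D) ∂D := by
  simpa only [Fin.insertNth_zero'] using integral_pi_insertNth D 0 hf hK

/-- Replacing one coordinate by an independent copy does not change an expectation. -/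
theorem integral_pi_update {n : ℕ} (j : Fin n) {f : (Fin n → Z) → ℝ}
    (hf : Measurable f) {K : ℝ} (hK : ∀ S, |f S| ≤ K) :
    ∫ S, ∫ z, f (Function.update S j z) ∂D ∂Measure.pi (fun _ : Fin n => D) =
      ∫ S, f S ∂Measure.pi (fun _ : Fin n => D) := by
  cases n with
  | zero => exact j.elim0
  | succ n =>
    rw [integral_pi_insertNth D j (f := fun S => ∫ z, f (Function.update S j z) ∂D)
      (Measurable.integral_right (by unfold Function.uncurry; fun_prop))
      fun S => abs_integral_le_of_abs_le fun z => hK _]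
    simp only [Fin.update_insertNth, integral_const, probReal_univ, one_smul]
    rw [integral_pi_insertNth D j hf hK]
    exact integral_integral_swap (integrable_of_abs_le (by unfold Function.uncurry; fun_prop)
      fun x => hK _)

/-- Both sides expand to the second moment minus the squared mean. The exponential bound uses the
centred form; the form with two independent copies can be compared with increments under resampling,
and its factor `1/2` is what gives `b²/2` per coordinate. -/
theorem integral_half_sq_sub_eq_variance {g : Z → ℝ} (hg : Measurable g) {K : ℝ}
    (hK : ∀ z, |g z| ≤ K) :
    (∫ p : Z × Z, (g p.1 - g p.2) ^ 2 ∂D.prod D) / 2 = ∫ z, (g z - ∫ w, g w ∂D) ^ 2 ∂D := by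
  have hK2 : ∀ z, |g z ^ 2| ≤ K ^ 2 := fun z => by
    rw [abs_pow]; exact pow_le_pow_left₀ (abs_nonneg _) (hK z) 2
  have i1 : Integrable g D := integrable_of_abs_le hg hK
  have i2 : Integrable (fun z => g z ^ 2) D := integrable_of_abs_le (by fun_prop) hK2
  have j1 : Integrable (fun p : Z × Z => g p.1 ^ 2) (D.prod D) :=
    integrable_of_abs_le (by fun_prop) fun p => hK2 _
  have j2 : Integrable (fun p : Z × Z => g p.2 ^ 2) (D.prod D) :=
    integrable_of_abs_le (by fun_prop) fun p => hK2 _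
  have j3 : Integrable (fun p : Z × Z => g p.1 * g p.2) (D.prod D) := i1.mul_prod i1
  have e1 : ∫ p : Z × Z, (g p.1 - g p.2) ^ 2 ∂D.prod D =
      2 * (∫ z, g z ^ 2 ∂D) - 2 * (∫ z, g z ∂D) ^ 2 := by
    have : ∀ p : Z × Z, (g p.1 - g p.2) ^ 2 = g p.1 ^ 2 + g p.2 ^ 2 - 2 * (g p.1 * g p.2) :=
      fun p => by ring
    simp only [this]
    have j12 : Integrable (fun p : Z × Z => g p.1 ^ 2 + g p.2 ^ 2) (D.prod D) := j1.add j2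
    rw [integral_sub j12 (j3.const_mul 2), integral_add j1 j2, integral_const_mul,
      integral_prod_mul, integral_fun_fst (f := fun z => g z ^ 2),
      integral_fun_snd (f := fun z => g z ^ 2)]
    simp
    ring
  have e2 : ∫ z, (g z - ∫ w, g w ∂D) ^ 2 ∂D = (∫ z, g z ^ 2 ∂D) - (∫ z, g z ∂D) ^ 2 := by
    set c := ∫ w, g w ∂D with hc
    have : ∀ z, (g z - c) ^ 2 = g z ^ 2 - 2 * c * g z + c ^ 2 := fun z => by ring
    simp only [this]
    have i12 : Integrable (fun z => g z ^ 2 - 2 * c * g z) D := i2.sub (i1.const_mul _)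
    rw [integral_add i12 (integrable_const _),
      integral_sub i2 (i1.const_mul _), integral_const_mul, ← hc]
    simp
    ring
  rw [e1, e2]
  ring

theorem sq_integral_le_integral_sq {μ : Measure X} [IsProbabilityMeasure μ] {f : X → ℝ}
    (hf : Measurable f) {K : ℝ} (hK : ∀ x, |f x| ≤ K) :
    (∫ x, f x ∂μ) ^ 2 ≤ ∫ x, f x ^ 2 ∂μ := by
  set c := ∫ x, f x ∂μ with hc
  have i1 : Integrable f μ := integrable_of_abs_le hf hK
  have i2 : Integrable (fun z => f z ^ 2) μ := integrable_of_abs_le (K := K ^ 2) (by fun_prop)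
    fun z => by rw [abs_pow]; exact pow_le_pow_left₀ (abs_nonneg _) (hK z) 2
  have h := integral_mono ((i1.const_mul (2 * c)).sub (integrable_const (c ^ 2))) i2
    fun x => show 2 * c * f x - c ^ 2 ≤ f x ^ 2 by nlinarith [sq_nonneg (f x - c)]
  simp only [Pi.sub_apply] at h
  rw [integral_sub (i1.const_mul _) (integrable_const _), integral_const_mul, ← hc] at h
  simp at h
  linarith

/-- A random variable with mean zero, bounded by one in absolute value, satisfies
`𝔼 exp X ≤ exp 𝔼 X²`. -/
theorem integral_exp_le_exp_integral_sq {μ : Measure X} [IsProbabilityMeasure μ] {f : X → ℝ}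
    (hf : Measurable f) (h1 : ∀ x, |f x| ≤ 1) (h0 : ∫ x, f x ∂μ = 0) :
    ∫ x, Real.exp (f x) ∂μ ≤ Real.exp (∫ x, f x ^ 2 ∂μ) := by
  have i1 : Integrable f μ := integrable_of_abs_le hf h1
  have i2 : Integrable (fun z => f z ^ 2) μ := integrable_of_abs_le (K := 1 ^ 2) (by fun_prop)
    fun z => by rw [abs_pow]; exact pow_le_pow_left₀ (abs_nonneg _) (h1 z) 2
  have i3 : Integrable (fun z => Real.exp (f z)) μ :=
    integrable_of_abs_le (K := Real.exp 1) (by fun_prop)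
    fun z => by rw [Real.abs_exp]; exact Real.exp_le_exp.2 (abs_le.1 (h1 z)).2
  have i4 : Integrable (fun x => 1 + f x) μ := (integrable_const 1).add i1
  -- On `[-1, 1]`, `exp x ≤ 1 + x + x²`; the linear term integrates to zero, and `1 + v ≤ exp v`
  -- finishes.
  have h := integral_mono i3 (i4.add i2)
    fun x => show Real.exp (f x) ≤ 1 + f x + f x ^ 2 by
      linarith [(abs_le.1 (Real.abs_exp_sub_one_sub_id_le (h1 x))).2]
  simp only [Pi.add_apply] at h
  rw [integral_add i4 i2, integral_add (integrable_const 1) i1, h0] at h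
  simp at h
  exact h.trans (by linarith [Real.add_one_le_exp (∫ x, f x ^ 2 ∂μ)])

end ProductMeasure

universe u

/-! ### Predictable quadratic variation and the exponential supermartingale -/

section QuadraticVariation

variable {Z : Type*} [MeasurableSpace Z]

/-- The predictable quadratic variation, at the sample `S`, of the martingale obtained by revealing
the coordinates of a function of `n` independent draws from `D` one at a time. -/
noncomputable def quadVar (D : Measure Z) : (n : ℕ) → ((Fin n → Z) → ℝ) → (Fin n → Z) → ℝ
  | 0, _, _ => 0
  | n + 1, f, S =>
    (∫ p : Z × Z, ((∫ T, f (Fin.cons p.1 T) ∂Measure.pi (fun _ : Fin n => D)) -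
      ∫ T, f (Fin.cons p.2 T) ∂Measure.pi (fun _ : Fin n => D)) ^ 2 ∂D.prod D) / 2 +
    quadVar D n (fun T => f (Fin.cons (S 0) T)) (Fin.tail S)

theorem quadVar_nonneg (D : Measure Z) (n : ℕ) (f : (Fin n → Z) → ℝ) (S : Fin n → Z) : 0 ≤ quadVar D n f S := by
  induction n with
  | zero => exact le_rfl
  | succ n ih =>
    exact add_nonneg (div_nonneg (integral_nonneg fun p => sq_nonneg _) zero_le_two) (ih _ _)

variable (D : Measure Z) [IsProbabilityMeasure D]

/-- The parameter `Y` makes the induction close: each recursive step fixes the head coordinate,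
which then joins the parameters as `Y × Z`. -/
theorem measurable_quadVar_param {Z : Type u} [MeasurableSpace Z] (D : Measure Z)
    [IsProbabilityMeasure D] (n : ℕ) {Y : Type u} [MeasurableSpace Y] (f : Y → (Fin n → Z) → ℝ)
    (hf : Measurable (Function.uncurry f)) :
    Measurable fun p : Y × (Fin n → Z) => quadVar D n (f p.1) p.2 := by
  induction n generalizing Y with
  | zero => exact measurable_const
  | succ n ih =>
    have hg : Measurable fun q : Y × Z =>
        ∫ T, f q.1 (Fin.cons q.2 T) ∂Measure.pi (fun _ : Fin n => D) :=
      Measurable.integral_right (hf.comp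
        (f := fun r : (Y × Z) × (Fin n → Z) => (r.1.1, (Fin.cons r.1.2 r.2 : Fin (n + 1) → Z)))
        (by fun_prop))
    refine Measurable.add (Measurable.div_const (Measurable.integral_right ?_) _) ?_
    · exact ((hg.comp (f := fun r : (Y × (Fin (n + 1) → Z)) × (Z × Z) => (r.1.1, r.2.1))
        (by fun_prop)).sub
        (hg.comp (f := fun r : (Y × (Fin (n + 1) → Z)) × (Z × Z) => (r.1.1, r.2.2))
        (by fun_prop))).pow_const 2
    · have := ih (Y := Y × Z) (fun q T => f q.1 (Fin.cons q.2 T)) (hf.comp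
        (f := fun r : (Y × Z) × (Fin n → Z) => (r.1.1, (Fin.cons r.1.2 r.2 : Fin (n + 1) → Z)))
        (by fun_prop))
      exact this.comp (f := fun r : Y × (Fin (n + 1) → Z) => ((r.1, r.2 0), Fin.tail r.2))
        (by fun_prop)

theorem measurable_quadVar (n : ℕ) {f : (Fin n → Z) → ℝ} (hf : Measurable f) :
    Measurable (quadVar D n f) :=
  (measurable_quadVar_param D n (fun _ : PUnit => f) (hf.comp measurable_snd)).comp
    (measurable_const.prodMk measurable_id : Measurable fun S => (PUnit.unit, S))

theorem quadVar_cons (n : ℕ) {f : (Fin (n + 1) → Z) → ℝ} (hf : Measurable f) {K : ℝ}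
    (hK : ∀ S, |f S| ≤ K) (z : Z) (T : Fin n → Z) :
    quadVar D (n + 1) f (Fin.cons z T) =
      (∫ w, ((∫ T, f (Fin.cons w T) ∂Measure.pi (fun _ : Fin n => D)) -
        ∫ S, f S ∂Measure.pi (fun _ : Fin (n + 1) => D)) ^ 2 ∂D) +
      quadVar D n (fun T => f (Fin.cons z T)) T := by
  rw [integral_pi_cons D hf hK, ← integral_half_sq_sub_eq_variance D
    (g := fun w => ∫ T, f (Fin.cons w T) ∂Measure.pi (fun _ : Fin n => D))
    (Measurable.integral_right (by unfold Function.uncurry; fun_prop))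
    fun w => abs_integral_le_of_abs_le fun T => hK _]
  simp [quadVar]

/-- Each coordinate contributes at most half of `(2K)²`. This crude bound serves integrability. -/
theorem quadVar_le (n : ℕ) {f : (Fin n → Z) → ℝ} {K : ℝ} (hK : ∀ S, |f S| ≤ K) (S : Fin n → Z) :
    quadVar D n f S ≤ n * (2 * K ^ 2) := by
  induction n with
  | zero => simp [quadVar]
  | succ n ih =>
    have h1 := ih (f := fun T => f (Fin.cons (S 0) T)) (fun T => hK _) (Fin.tail S)
    have h2 := (abs_le.1 (abs_integral_le_of_abs_le (μ := D.prod D) (K := 4 * K ^ 2)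
      (f := fun p : Z × Z => ((∫ T, f (Fin.cons p.1 T) ∂Measure.pi (fun _ : Fin n => D)) -
      ∫ T, f (Fin.cons p.2 T) ∂Measure.pi (fun _ : Fin n => D)) ^ 2) fun p => by
        have a := abs_le.1 (abs_integral_le_of_abs_le (μ := Measure.pi (fun _ : Fin n => D))
          (f := fun T => f (Fin.cons p.1 T)) fun T => hK _)
        have b := abs_le.1 (abs_integral_le_of_abs_le (μ := Measure.pi (fun _ : Fin n => D))
          (f := fun T => f (Fin.cons p.2 T)) fun T => hK _)
        rw [abs_of_nonneg (sq_nonneg _)]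
        nlinarith)).2
    rw [quadVar]
    push_cast
    linarith

/-- The exponential supermartingale attached to the quadratic variation. -/
theorem integral_exp_sub_quadVar_le_one (n : ℕ) {f : (Fin n → Z) → ℝ} (hf : Measurable f) {K B t : ℝ}
    (hK : ∀ S, |f S| ≤ K) (hB : ∀ S k z, |f S - f (Function.update S k z)| ≤ B)
    (ht : 0 ≤ t) (htB : t * B ≤ 1) :
    ∫ S, Real.exp (t * (f S - ∫ T, f T ∂Measure.pi (fun _ : Fin n => D)) -
      t ^ 2 * quadVar D n f S) ∂Measure.pi (fun _ : Fin n => D) ≤ 1 := by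
  have hexp : ∀ (n : ℕ) (f : (Fin n → Z) → ℝ) (_ : ∀ S, |f S| ≤ K) (S : Fin n → Z),
      |Real.exp (t * (f S - ∫ T, f T ∂Measure.pi (fun _ : Fin n => D)) -
        t ^ 2 * quadVar D n f S)| ≤ Real.exp (t * (2 * K)) := by
    intro n f hK S
    rw [Real.abs_exp, Real.exp_le_exp]
    have h1 := mul_nonneg (sq_nonneg t) (quadVar_nonneg D n f S)
    have h2 := abs_le.1 (abs_integral_le_of_abs_le (μ := Measure.pi (fun _ : Fin n => D)) hK)
    have h3 := mul_le_mul_of_nonneg_left (show f S - ∫ T, f T ∂Measure.pi (fun _ : Fin n => D) ≤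
      2 * K by linarith [(abs_le.1 (hK S)).2]) ht
    linarith
  induction n with
  | zero =>
    rw [Measure.pi_of_empty]
    simp [quadVar, Subsingleton.elim _ (isEmptyElim : (a : Fin 0) → Z)]
  | succ n ih =>
    set E := ∫ T, f T ∂Measure.pi (fun _ : Fin (n + 1) => D) with hE
    set g : Z → ℝ := fun z => ∫ T, f (Fin.cons z T) ∂Measure.pi (fun _ : Fin n => D) with hg
    have hgm : Measurable g := Measurable.integral_right (by unfold Function.uncurry; fun_prop)
    have hgK : ∀ z, |g z| ≤ K := fun z => abs_integral_le_of_abs_le fun T => hK _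
    have hEg : E = ∫ z, g z ∂D := integral_pi_cons D hf hK
    have hcons : ∀ z, Measurable fun T : Fin n → Z => f (Fin.cons z T) := fun z => by fun_prop
    -- The martingale increment is an average of differences of `f` at samples that differ only in
    -- the head coordinate, so it inherits the bound `B`.
    have hgE : ∀ z, |g z - E| ≤ B := fun z => by
      have : g z - E = ∫ w, ∫ T, (f (Fin.cons z T) - f (Fin.cons w T))
          ∂Measure.pi (fun _ : Fin n => D) ∂D := by
        simp_rw [fun w => integral_sub (integrable_of_abs_le
          (μ := Measure.pi (fun _ : Fin n => D)) (hcons z) fun T => hK _)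
          (integrable_of_abs_le (hcons w) fun T => hK _)]
        rw [integral_sub (integrable_const _) (integrable_of_abs_le hgm hgK), ← hEg]
        simp [hg]
      rw [this]
      refine abs_integral_le_of_abs_le fun w => abs_integral_le_of_abs_le fun T => ?_
      simpa using hB (Fin.cons z T) 0 w
    set V := ∫ w, (g w - E) ^ 2 ∂D with hV
    have hqm := measurable_quadVar D (n + 1) hf
    rw [integral_pi_cons D (by fun_prop) (hexp _ f hK)]
    -- Given the head `z`, the exponent splits into the first increment, the first conditional
    -- variance `V`, which does not depend on `z`, and the exponent for the tail, to which the
    -- induction hypothesis applies.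
    have hinner : ∀ z, ∫ T, Real.exp (t * (f (Fin.cons z T) - E) -
        t ^ 2 * quadVar D (n + 1) f (Fin.cons z T)) ∂Measure.pi (fun _ : Fin n => D) ≤
        Real.exp (t * (g z - E)) * Real.exp (- (t ^ 2 * V)) := by
      intro z
      have h1 : ∀ T : Fin n → Z, Real.exp (t * (f (Fin.cons z T) - E) -
          t ^ 2 * quadVar D (n + 1) f (Fin.cons z T)) =
          Real.exp (t * (g z - E)) * Real.exp (- (t ^ 2 * V)) *
          Real.exp (t * (f (Fin.cons z T) - g z) -
            t ^ 2 * quadVar D n (fun T => f (Fin.cons z T)) T) := by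
        intro T
        rw [quadVar_cons D n hf hK, ← Real.exp_add, ← Real.exp_add]
        congr 1
        ring
      simp_rw [h1]
      rw [integral_const_mul]
      refine mul_le_of_le_one_right (by positivity) (ih (hcons z) (fun T => hK _) ?_)
      intro S k w
      rw [Fin.cons_update]
      exact hB _ _ _
    have hm2 : Measurable fun z => ∫ T, Real.exp (t * (f (Fin.cons z T) - E) -
        t ^ 2 * quadVar D (n + 1) f (Fin.cons z T)) ∂Measure.pi (fun _ : Fin n => D) :=
      Measurable.integral_right (by unfold Function.uncurry; fun_prop)
    have hb : ∀ z, |t * (g z - E)| ≤ 1 := fun z => by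
      rw [abs_mul, abs_of_nonneg ht]
      exact (mul_le_mul_of_nonneg_left (hgE z) ht).trans htB
    have hei : Integrable (fun z => Real.exp (t * (g z - E))) D :=
      integrable_of_abs_le (K := Real.exp 1) (by fun_prop) fun z => by
        rw [Real.abs_exp]; exact Real.exp_le_exp.2 (abs_le.1 (hb z)).2
    refine (integral_mono (integrable_of_abs_le hm2 fun z => abs_integral_le_of_abs_le
      fun T => hexp _ f hK _) (hei.mul_const _) hinner).trans ?_
    have h0 : ∫ z, t * (g z - E) ∂D = 0 := by
      rw [integral_const_mul, integral_sub (integrable_of_abs_le hgm hgK) (integrable_const _),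
        ← hEg]
      simp
    have h := integral_exp_le_exp_integral_sq (μ := D) (by fun_prop) hb h0
    simp_rw [mul_pow] at h
    rw [integral_const_mul, ← hV] at h
    rw [integral_mul_const]
    calc _ ≤ Real.exp (t ^ 2 * V) * Real.exp (-(t ^ 2 * V)) :=
          mul_le_mul_of_nonneg_right h (Real.exp_pos _).le
      _ = 1 := by rw [← Real.exp_add]; simp

/-- The quadratic variation exceeds `n b² / 2` on average by at most half the excess over `b²` of
the squared increments under resampling of one coordinate. -/
theorem integral_quadVar_excess_le (n : ℕ) {f : (Fin n → Z) → ℝ} (hf : Measurable f) {K b : ℝ}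
    (hK : ∀ S, |f S| ≤ K) :
    ∫ S, max (quadVar D n f S - n * (b ^ 2 / 2)) 0 ∂Measure.pi (fun _ : Fin n => D) ≤
      (∑ k, ∫ S, ∫ z, max ((f S - f (Function.update S k z)) ^ 2 - b ^ 2) 0 ∂D
        ∂Measure.pi (fun _ : Fin n => D)) / 2 := by
  have hexc : ∀ x y : ℝ, |x| ≤ K → |y| ≤ K → |max ((x - y) ^ 2 - b ^ 2) 0| ≤ 4 * K ^ 2 := by
    intro x y hx hy
    rw [abs_of_nonneg (le_max_right _ _)]
    have := abs_le.1 hx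
    have := abs_le.1 hy
    exact max_le (by nlinarith [sq_nonneg b]) (by positivity)
  have hqv : ∀ (n : ℕ) (f : (Fin n → Z) → ℝ) (_ : ∀ S, |f S| ≤ K) (S : Fin n → Z),
      |max (quadVar D n f S - n * (b ^ 2 / 2)) 0| ≤ n * (2 * K ^ 2) := by
    intro n f hK S
    rw [abs_of_nonneg (le_max_right _ _)]
    refine max_le ?_ (by positivity)
    have := quadVar_le D n hK S
    have : 0 ≤ (n : ℝ) * (b ^ 2 / 2) := by positivity
    linarith
  induction n with
  | zero => simp [quadVar]
  | succ n ih =>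
    set P := Measure.pi (fun _ : Fin n => D) with hP
    have hcons : ∀ z, Measurable fun T : Fin n → Z => f (Fin.cons z T) := fun z => by fun_prop
    set V := (∫ p : Z × Z, ((∫ T, f (Fin.cons p.1 T) ∂P) - ∫ T, f (Fin.cons p.2 T) ∂P) ^ 2
      ∂D.prod D) / 2 with hV
    have hqm := measurable_quadVar D (n + 1) hf
    -- Jensen's inequality moves the square inside the integral over the common tail `T`; then `x² ≤
    -- (x² - b²)₊ + b²` pointwise.
    have hVb : max (V - b ^ 2 / 2) 0 ≤ (∫ z, ∫ T, ∫ w,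
        max ((f (Fin.cons z T) - f (Fin.cons w T)) ^ 2 - b ^ 2) 0 ∂D ∂P ∂D) / 2 := by
      set G : Z → Z → (Fin n → Z) → ℝ := fun z w T =>
        max ((f (Fin.cons z T) - f (Fin.cons w T)) ^ 2 - b ^ 2) 0 with hG
      have hGK : ∀ z w T, |G z w T| ≤ 4 * K ^ 2 := fun z w T => hexc _ _ (hK _) (hK _)
      have hGm : Measurable fun p : Z × Z => ∫ T, G p.1 p.2 T ∂P :=
        Measurable.integral_right (by unfold Function.uncurry; fun_prop)
      have hGi : Integrable (fun p : Z × Z => ∫ T, G p.1 p.2 T ∂P) (D.prod D) :=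
        integrable_of_abs_le hGm fun p => abs_integral_le_of_abs_le (hGK _ _)
      have hswap : ∫ z, ∫ T, ∫ w, G z w T ∂D ∂P ∂D = ∫ p : Z × Z, ∫ T, G p.1 p.2 T ∂P ∂D.prod D := by
        rw [integral_prod _ hGi]
        exact integral_congr_ae (ae_of_all _ fun z => integral_integral_swap
          (integrable_of_abs_le (by unfold Function.uncurry; fun_prop) fun x => hGK _ _ _))
      have hgm : Measurable fun z => ∫ T, f (Fin.cons z T) ∂P :=
        Measurable.integral_right (by unfold Function.uncurry; fun_prop)
      have hpt : ∀ p : Z × Z, ((∫ T, f (Fin.cons p.1 T) ∂P) - ∫ T, f (Fin.cons p.2 T) ∂P) ^ 2 ≤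
          (∫ T, G p.1 p.2 T ∂P) + b ^ 2 := by
        intro p
        have i0 : Integrable (G p.1 p.2) P := integrable_of_abs_le (by fun_prop) (hGK _ _)
        have hd : ∀ T : Fin n → Z, |f (Fin.cons p.1 T) - f (Fin.cons p.2 T)| ≤ 2 * K := fun T => by
          linarith [abs_sub (f (Fin.cons p.1 T)) (f (Fin.cons p.2 T)), hK (Fin.cons p.1 T),
            hK (Fin.cons p.2 T)]
        rw [← integral_sub (integrable_of_abs_le (hcons _) fun T => hK _)
          (integrable_of_abs_le (hcons _) fun T => hK _)]
        refine (sq_integral_le_integral_sq (by fun_prop) hd).trans ?_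
        have := integral_mono (μ := P) (f := fun T => (f (Fin.cons p.1 T) - f (Fin.cons p.2 T)) ^ 2)
          (integrable_of_abs_le (K := (2 * K) ^ 2) (by fun_prop) fun T => by
            rw [abs_pow]; exact pow_le_pow_left₀ (abs_nonneg _) (hd T) 2)
          (i0.add (integrable_const (b ^ 2))) fun T => by
            simp only [Pi.add_apply, hG]
            linarith [le_max_left ((f (Fin.cons p.1 T) - f (Fin.cons p.2 T)) ^ 2 - b ^ 2) 0]
        simp only [Pi.add_apply] at this
        rw [integral_add i0 (integrable_const _)] at this
        simpa using this
      rw [hswap]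
      refine max_le ?_ (div_nonneg (integral_nonneg fun p => integral_nonneg fun T =>
        le_max_right _ _) zero_le_two)
      have := integral_mono_of_nonneg (μ := D.prod D) (ae_of_all _ fun p => sq_nonneg _)
        (hGi.add (integrable_const (b ^ 2))) (ae_of_all _ hpt)
      simp only [Pi.add_apply] at this
      rw [integral_add hGi (integrable_const _)] at this
      simp only [integral_const, probReal_univ, one_smul] at this
      rw [hV]
      linarith
    set e : Fin n → Z → ℝ := fun k z => ∫ T, ∫ w,
      max ((f (Fin.cons z T) - f (Fin.cons z (Function.update T k w))) ^ 2 - b ^ 2) 0 ∂D ∂P with he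
    have hem : ∀ k, Measurable (e k) := fun k => Measurable.integral_right (Measurable.integral_right
      (f := fun (q : Z × (Fin n → Z)) w => max ((f (Fin.cons q.1 q.2) -
        f (Fin.cons q.1 (Function.update q.2 k w))) ^ 2 - b ^ 2) 0)
        (by unfold Function.uncurry; fun_prop))
    have heK : ∀ k z, |e k z| ≤ 4 * K ^ 2 := fun k z => abs_integral_le_of_abs_le fun T =>
      abs_integral_le_of_abs_le fun w => hexc _ _ (hK _) (hK _)
    have hei : ∀ k, Integrable (e k) D := fun k => integrable_of_abs_le (hem k) (heK k)
    have hinner : ∀ z, ∫ T, max (quadVar D (n + 1) f (Fin.cons z T) - (n + 1 : ℕ) * (b ^ 2 / 2)) 0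
        ∂P ≤ max (V - b ^ 2 / 2) 0 + (∑ k, e k z) / 2 := by
      intro z
      have hqz := measurable_quadVar D n (hcons z)
      have i1 : Integrable (fun T => max (quadVar D n (fun T => f (Fin.cons z T)) T -
          n * (b ^ 2 / 2)) 0) P := integrable_of_abs_le (by fun_prop) (hqv n _ fun T => hK _)
      refine (integral_mono (integrable_of_abs_le (by fun_prop) fun T => hqv _ f hK _)
        ((integrable_const (max (V - b ^ 2 / 2) 0)).add i1) fun T => ?_).trans ?_
      · have : quadVar D (n + 1) f (Fin.cons z T) = V + quadVar D n (fun T => f (Fin.cons z T)) T :=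
          by simp [quadVar, hV, hP]
        simp only [this, Pi.add_apply]
        push_cast
        refine max_le ?_ (add_nonneg (le_max_right _ _) (le_max_right _ _))
        -- Subadditivity of the positive part: each of the `n + 1` coordinates receives its own
        -- allowance `b²/2`.
        linarith [le_max_left (V - b ^ 2 / 2) 0,
          le_max_left (quadVar D n (fun T => f (Fin.cons z T)) T - n * (b ^ 2 / 2)) 0]
      · simp only [Pi.add_apply]
        rw [integral_add (integrable_const _) i1]
        have := ih (hcons z) fun T => hK _
        simp only [integral_const, probReal_univ, one_smul]
        linarith
    rw [integral_pi_cons D (by fun_prop) (hqv _ f hK)]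
    refine (integral_mono (integrable_of_abs_le (Measurable.integral_right
      (by unfold Function.uncurry; fun_prop)) fun z => abs_integral_le_of_abs_le fun T =>
      hqv _ f hK _) ((integrable_const _).add ((integrable_finsetSum _ fun k _ => hei k).div_const 2))
      hinner).trans ?_
    simp only [Pi.add_apply]
    rw [integral_add (integrable_const _) ((integrable_finsetSum _ fun k _ => hei k).div_const 2),
      integral_div, integral_finsetSum _ fun k _ => hei k, Fin.sum_univ_succ]
    have hk : ∀ k : Fin (n + 1), ∫ S, ∫ z, max ((f S - f (Function.update S k z)) ^ 2 - b ^ 2) 0 ∂D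
        ∂Measure.pi (fun _ : Fin (n + 1) => D) = ∫ z, ∫ T, ∫ w, max ((f (Fin.cons z T) -
          f (Function.update (Fin.cons z T : Fin (n + 1) → Z) k w)) ^ 2 - b ^ 2) 0 ∂D ∂P ∂D :=
      fun k => integral_pi_cons D (f := fun S => ∫ z, max ((f S - f (Function.update S k z)) ^ 2
        - b ^ 2) 0 ∂D) (Measurable.integral_right (by unfold Function.uncurry; fun_prop))
        fun S => abs_integral_le_of_abs_le fun w => hexc _ _ (hK _) (hK _)
    simp only [hk, Fin.update_cons_zero, ← Fin.cons_update]
    simp only [integral_const, probReal_univ, one_smul]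
    linarith

end QuadraticVariation

/-! ### Concentration with rarely large differences -/

section Concentration

variable {Z : Type*} [MeasurableSpace Z] (D : Measure Z) [IsProbabilityMeasure D]

/-- A bounded-difference inequality in which the differences exceed `b` only rarely. -/
theorem measureReal_integral_add_lt_le (n : ℕ) {f : (Fin n → Z) → ℝ} (hf : Measurable f)
    {K B t b u s : ℝ} (hK : ∀ S, |f S| ≤ K)
    (hB : ∀ S k z, |f S - f (Function.update S k z)| ≤ B)
    (ht : 0 ≤ t) (htB : t * B ≤ 1) (hs : 0 < s) :
    (Measure.pi (fun _ : Fin n => D)).real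
      {S | (∫ T, f T ∂Measure.pi (fun _ : Fin n => D)) + u < f S} ≤
      Real.exp (t ^ 2 * (n * (b ^ 2 / 2) + s) - t * u) +
      (∑ k, ∫ S, ∫ z, max ((f S - f (Function.update S k z)) ^ 2 - b ^ 2) 0 ∂D
        ∂Measure.pi (fun _ : Fin n => D)) / (2 * s) := by
  set P := Measure.pi (fun _ : Fin n => D) with hP
  set E := ∫ T, f T ∂P with hE
  have hq := measurable_quadVar D n hf
  have hEK := abs_le.1 (abs_integral_le_of_abs_le (μ := P) hK)
  have i1 : Integrable (fun S => Real.exp (t * (f S - E) - t ^ 2 * quadVar D n f S)) P := by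
    refine integrable_of_abs_le (K := Real.exp (t * (2 * K))) (by fun_prop) fun S => ?_
    rw [Real.abs_exp, Real.exp_le_exp]
    have h1 := mul_nonneg (sq_nonneg t) (quadVar_nonneg D n f S)
    have h3 := mul_le_mul_of_nonneg_left (show f S - E ≤ 2 * K by
      linarith [(abs_le.1 (hK S)).2]) ht
    linarith
  have i2 : Integrable (fun S => max (quadVar D n f S - n * (b ^ 2 / 2)) 0) P := by
    refine integrable_of_abs_le (K := n * (2 * K ^ 2)) (by fun_prop) fun S => ?_
    rw [abs_of_nonneg (le_max_right _ _)]
    refine max_le ?_ (by positivity)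
    have := quadVar_le D n hK S
    have : 0 ≤ (n : ℝ) * (b ^ 2 / 2) := by positivity
    linarith
  set a := Real.exp (t * u - t ^ 2 * (n * (b ^ 2 / 2) + s)) with ha
  have m1 := mul_meas_ge_le_integral_of_nonneg (ae_of_all _ fun S => (Real.exp_pos _).le) i1 a
  have m2 : s * P.real {S | s ≤ max (quadVar D n f S - n * (b ^ 2 / 2)) 0} ≤
      ∫ S, max (quadVar D n f S - n * (b ^ 2 / 2)) 0 ∂P :=
    mul_meas_ge_le_integral_of_nonneg (ae_of_all _ fun S => le_max_right _ _) i2 s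
  have n1 := m1.trans (integral_exp_sub_quadVar_le_one D n hf hK hB ht htB)
  have n2 := m2.trans (integral_quadVar_excess_le D n hf (b := b) hK)
  -- Either the quadratic variation exceeds its allowance by at least `s`, or the exponential
  -- supermartingale is at least `a`; Markov's inequality handles both events.
  have hsub : {S | E + u < f S} ⊆
      {S | a ≤ Real.exp (t * (f S - E) - t ^ 2 * quadVar D n f S)} ∪
      {S | s ≤ max (quadVar D n f S - n * (b ^ 2 / 2)) 0} := by
    intro S hS
    by_cases h : s ≤ max (quadVar D n f S - n * (b ^ 2 / 2)) 0
    · exact Or.inr h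
    · left
      have h' := (le_max_left _ _).trans (not_le.1 h).le
      have hS' : E + u < f S := hS
      have h1 := mul_le_mul_of_nonneg_left h' (sq_nonneg t)
      have h2 := mul_le_mul_of_nonneg_left (show u ≤ f S - E by linarith) ht
      simp only [Set.mem_ofPred_eq, ha, Real.exp_le_exp]
      linarith
  refine (measureReal_mono hsub).trans ((measureReal_union_le _ _).trans (add_le_add ?_ ?_))
  · have : Real.exp (t ^ 2 * (n * (b ^ 2 / 2) + s) - t * u) = a⁻¹ := by
      rw [ha, ← Real.exp_neg]; congr 1; ring
    rw [this, ← one_div, le_div_iff₀' (Real.exp_pos _)]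
    exact n1
  · rw [le_div_iff₀' (by positivity)]
    linarith

end Concentration

/-! ### Leave-one-out empirical averages -/

section LeaveOneOut

variable {Z : Type*} [MeasurableSpace Z]

/-- The deviation of `(1/n) ∑_{j ≠ k} g (S j)` from its mean. -/
noncomputable def leaveOneOutDev (D : Measure Z) {n : ℕ} (g : Z → ℝ) (k : Fin n) (S : Fin n → Z) : ℝ :=
  (∑ j, if j = k then 0 else g (S j) - ∫ z, g z ∂D) / n

theorem leaveOneOutDev_update (D : Measure Z) {n : ℕ} (g : Z → ℝ) (k : Fin n) (S : Fin n → Z) (z : Z) :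
    leaveOneOutDev D g k (Function.update S k z) = leaveOneOutDev D g k S := by
  unfold leaveOneOutDev
  congr 1
  refine Finset.sum_congr rfl fun j _ => ?_
  by_cases h : j = k <;> simp [h]

/-- The summands are independent and centred, so variances add: at most `n` terms of size `M²`,
divided by `n²`. Each summand is bounded by `M`, not `2M`, because `g` and its mean both lie in `[0,
M]`. -/
theorem integral_sq_leaveOneOutDev_le (D : Measure Z) [IsProbabilityMeasure D] {n : ℕ} {g : Z → ℝ} (hg : Measurable g) {M : ℝ}
    (h0 : ∀ z, 0 ≤ g z) (hM : ∀ z, g z ≤ M) (k : Fin n) :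
    ∫ S, leaveOneOutDev D g k S ^ 2 ∂Measure.pi (fun _ : Fin n => D) ≤ M ^ 2 / n := by
  set c := ∫ z, g z ∂D with hc
  have i0 : Integrable g D := integrable_of_abs_le hg fun z => by
    rw [abs_of_nonneg (h0 z)]; exact hM z
  have hc0 : 0 ≤ c := integral_nonneg h0
  have hcM : c ≤ M := integral_le_of_le i0 hM
  have hM0 : 0 ≤ M := hc0.trans hcM
  let X : Fin n → Z → ℝ := fun j z => if j = k then 0 else g z - c
  have hXm : ∀ j, Measurable (X j) := fun j => by
    by_cases h : j = k
    · simp only [X, h, if_true]; fun_prop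
    · simp only [X, h, if_false]; fun_prop
  have hXM : ∀ j z, |X j z| ≤ M := fun j z => by
    by_cases h : j = k
    · simpa [X, h] using hM0
    · simp only [X, h, if_false, abs_le]
      constructor <;> linarith [h0 z, hM z]
  have hX2 : ∀ j, MemLp (X j) 2 D := fun j =>
    MemLp.of_bound (hXm j).aestronglyMeasurable M (ae_of_all _ (hXM j))
  have hX0 : ∀ j, ∫ z, X j z ∂D = 0 := fun j => by
    by_cases h : j = k
    · simp [X, h]
    · simp only [X, h, if_false]
      rw [integral_sub i0 (integrable_const _)]
      simp [hc]
  have hv := ProbabilityTheory.variance_sum_pi (μ := fun _ : Fin n => D) hX2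
  have hmean : ∫ S, (∑ j, fun S : Fin n → Z => X j (S j)) S ∂Measure.pi (fun _ : Fin n => D) = 0 := by
    simp only [Finset.sum_apply]
    rw [integral_finsetSum]
    · refine Finset.sum_eq_zero fun j _ => ?_
      rw [integral_comp_eval (μ := fun _ : Fin n => D) (hXm j).aestronglyMeasurable, hX0]
    · exact fun j _ => integrable_of_abs_le ((hXm j).comp (measurable_pi_apply j)) fun S => hXM _ _
  have hsm : Measurable (∑ j, fun S : Fin n → Z => X j (S j)) := by
    convert Finset.measurable_sum Finset.univ
      fun j _ => (hXm j).comp (measurable_pi_apply (X := fun _ : Fin n => Z) j) using 1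
    ext S
    simp
  rw [ProbabilityTheory.variance_of_integral_eq_zero hsm.aemeasurable hmean] at hv
  have hle : ∀ j, ProbabilityTheory.variance (X j) D ≤ M ^ 2 := fun j => by
    rw [ProbabilityTheory.variance_of_integral_eq_zero (hXm j).aemeasurable (hX0 j)]
    have hsq : ∀ z, |X j z ^ 2| ≤ M ^ 2 := fun z => by
      rw [abs_pow]; exact pow_le_pow_left₀ (abs_nonneg _) (hXM j z) 2
    exact (abs_le.1 (abs_integral_le_of_abs_le hsq)).2
  have hsum := Finset.sum_le_sum fun j (_ : j ∈ Finset.univ) => hle j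
  rw [← hv] at hsum
  simp only [Finset.sum_apply, Finset.sum_const, Finset.card_univ, Fintype.card_fin,
    nsmul_eq_mul] at hsum
  have hn : (0 : ℝ) < n := by exact_mod_cast k.pos
  simp only [leaveOneOutDev, div_pow]
  rw [integral_div, div_le_div_iff₀ (by positivity) hn]
  calc _ ≤ (n * M ^ 2) * (n : ℝ) := mul_le_mul_of_nonneg_right hsum hn.le
    _ = _ := by ring

end LeaveOneOut

/-! ### Averaged sensitivity and consequences of stability -/

theorem avgSensitivity_nonneg {Z : Type*} [MeasurableSpace Z] {D : Measure Z} {β : Z → Z → ℝ}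
    (h0 : ∀ z' z, 0 ≤ β z' z) : 0 ≤ avgSensitivity D β :=
  Real.iSup_nonneg fun x => integral_nonneg (h0 x)

theorem abs_loss_le {Z F : Type*} {l : F → Z → ℝ} {Ml : ℝ}
    (hl : ∀ f z, 0 ≤ l f z ∧ l f z ≤ Ml) (f : F) (z : Z) : |l f z| ≤ Ml := by
  rw [abs_of_nonneg (hl f z).1]
  exact (hl f z).2

section Sensitivity

variable {Z : Type*} [MeasurableSpace Z] {D : Measure Z} [IsProbabilityMeasure D]
  {β : Z → Z → ℝ} {M : ℝ}

theorem integral_le_avgSensitivity (hM : ∀ z' z, |β z' z| ≤ M) (x : Z) :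
    ∫ z, β x z ∂D ≤ avgSensitivity D β :=
  -- The uniform bound `M` makes the family bounded above, so the real supremum is genuine and not
  -- the default value `0`.
  le_ciSup (f := fun x => ∫ z, β x z ∂D)
    ⟨M, Set.forall_mem_range.2 fun x => (abs_le.1 (abs_integral_le_of_abs_le (hM x))).2⟩ x

theorem avgSensitivity_le [Nonempty Z] (hM : ∀ z' z, |β z' z| ≤ M) : avgSensitivity D β ≤ M :=
  ciSup_le fun x => (abs_le.1 (abs_integral_le_of_abs_le (hM x))).2

end Sensitivity

theorem LocallyElasticStable.nonneg {Z F : Type*} {A : LearningAlgorithm Z F} {l : F → Z → ℝ}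
    {βm : ℕ → Z → Z → ℝ} (h : LocallyElasticStable A l βm) {m : ℕ} (hm : 2 ≤ m) (z' z : Z) :
    0 ≤ βm m z' z := by
  obtain ⟨n, rfl⟩ : ∃ n, m = n + 1 := ⟨m - 1, by omega⟩
  exact (abs_nonneg _).trans (h n (by omega) (fun _ => z') 0 z)

/-- Both samples become the same one once entry `j` is removed, so two applications of stability and
the triangle inequality suffice. -/
theorem LocallyElasticStable.abs_sub_update_le {Z F : Type*} {A : LearningAlgorithm Z F}
    {l : F → Z → ℝ} {βm : ℕ → Z → Z → ℝ} (h : LocallyElasticStable A l βm) {m : ℕ} (hm : 2 ≤ m)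
    (S : Fin m → Z) (j : Fin m) (w z : Z) :
    |l (A m S) z - l (A m (Function.update S j w)) z| ≤ βm m (S j) z + βm m w z := by
  obtain ⟨n, rfl⟩ : ∃ n, m = n + 1 := ⟨m - 1, by omega⟩
  have h1 := abs_le.1 (h n (by omega) S j z)
  have h2 := abs_le.1 (h n (by omega) (Function.update S j w) j z)
  rw [Fin.removeNth_update, Function.update_self] at h2
  rw [abs_le]
  constructor <;> linarith

/-! ### Mean and increments of the generalization gap -/

section Defect

variable {Z F : Type*} [MeasurableSpace Z] {D : Measure Z} [IsProbabilityMeasure D]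
  {A : LearningAlgorithm Z F} {l : F → Z → ℝ} {β : Z → Z → ℝ} {m : ℕ} {Ml M : ℝ}

theorem measurable_defect (hmeas : Measurable fun p : (Fin m → Z) × Z => l (A m p.1) p.2) :
    Measurable (defect D A l m) := by
  unfold defect
  refine (Measurable.integral_right hmeas).sub ((Finset.measurable_sum _ fun j _ => ?_).div_const _)
  exact hmeas.comp (measurable_id.prodMk (measurable_pi_apply j))

theorem abs_defect_le (hmeas : Measurable fun p : (Fin m → Z) × Z => l (A m p.1) p.2)
    (hl : ∀ f z, 0 ≤ l f z ∧ l f z ≤ Ml) (hm : 0 < m) (S : Fin m → Z) :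
    |defect D A l m S| ≤ Ml := by
  have hm' : (0 : ℝ) < m := by exact_mod_cast hm
  have i : Integrable (l (A m S)) D :=
    integrable_of_abs_le (hmeas.comp measurable_prodMk_left) (abs_loss_le hl _)
  have a0 : 0 ≤ ∫ z, l (A m S) z ∂D := integral_nonneg fun z => (hl _ z).1
  have a1 : ∫ z, l (A m S) z ∂D ≤ Ml := integral_le_of_le i fun z => (hl _ z).2
  have b0 : 0 ≤ (∑ j : Fin m, l (A m S) (S j)) / m :=
    div_nonneg (Finset.sum_nonneg fun j _ => (hl _ _).1) hm'.le
  have b1 : (∑ j : Fin m, l (A m S) (S j)) / m ≤ Ml := by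
    rw [div_le_iff₀' hm']
    simpa using Finset.sum_le_sum fun (j : Fin m) (_ : j ∈ Finset.univ) => (hl (A m S) (S j)).2
  rw [defect, abs_le]
  constructor <;> linarith

/-- Stability bounds the expected generalization gap. -/
theorem integral_defect_le (hmeas : Measurable fun p : (Fin m → Z) × Z => l (A m p.1) p.2)
    (hl : ∀ f z, 0 ≤ l f z ∧ l f z ≤ Ml) (hm : 0 < m) (hβ : Measurable (Function.uncurry β))
    (hM : ∀ z' z, |β z' z| ≤ M)
    (hupd : ∀ S j w z, |l (A m S) z - l (A m (Function.update S j w)) z| ≤ (β (S j) z + β w z) / m) :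
    ∫ S, defect D A l m S ∂Measure.pi (fun _ : Fin m => D) ≤ (avgSensitivity D β + M) / m := by
  have hm' : (0 : ℝ) < m := by exact_mod_cast hm
  set P := Measure.pi (fun _ : Fin m => D) with hP
  have hlK := abs_loss_le hl
  have hm1 : ∀ j : Fin m, Measurable fun S : Fin m → Z => l (A m S) (S j) := fun j =>
    hmeas.comp (measurable_id.prodMk (measurable_pi_apply j))
  have hm2 : Measurable fun S : Fin m → Z => ∫ z, l (A m S) z ∂D := Measurable.integral_right hmeas
  have i1 : ∀ j : Fin m, Integrable (fun S : Fin m → Z => l (A m S) (S j)) P := fun j =>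
    integrable_of_abs_le (hm1 j) fun S => hlK _ _
  have i2 : Integrable (fun S : Fin m → Z => ∫ z, l (A m S) z ∂D) P :=
    integrable_of_abs_le hm2 fun S => abs_integral_le_of_abs_le (hlK _)
  have hj : ∀ j : Fin m, (∫ S, ∫ z, l (A m S) z ∂D ∂P) - ∫ S, l (A m S) (S j) ∂P ≤
      (avgSensitivity D β + M) / m := by
    intro j
    have hm3 : Measurable (Function.uncurry fun (S : Fin m → Z) z =>
        l (A m (Function.update S j z)) z) :=
      hmeas.comp (f := fun p : (Fin m → Z) × Z => (Function.update p.1 j p.2, p.2)) (by fun_prop)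
    have i3 : Integrable (fun S : Fin m → Z => ∫ z, l (A m (Function.update S j z)) z ∂D) P :=
      integrable_of_abs_le (Measurable.integral_right hm3)
        fun S => abs_integral_le_of_abs_le fun z => hlK _ _
    -- Resampling `z_j` turns the training loss at `z_j` into the loss at a fresh `z` of the
    -- algorithm trained with `z` in place `j`, so stability compares it with the population loss.
    rw [← integral_pi_update D j (hm1 j) fun S => hlK _ _]
    simp only [Function.update_self]
    rw [← integral_sub i2 i3]
    refine integral_le_of_le (i2.sub i3) fun S => ?_
    have i4 : Integrable (l (A m S)) D :=
      integrable_of_abs_le (hmeas.comp measurable_prodMk_left) (hlK _)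
    have i5 : Integrable (fun z => l (A m (Function.update S j z)) z) D :=
      integrable_of_abs_le (hm3.comp measurable_prodMk_left) fun z => hlK _ _
    have i6 : Integrable (β (S j)) D :=
      integrable_of_abs_le (hβ.comp measurable_prodMk_left) (hM _)
    simp only [Pi.sub_apply]
    rw [← integral_sub i4 i5]
    refine (integral_mono (i4.sub i5) ((i6.add (integrable_const M)).div_const (m : ℝ))
      fun z => ?_).trans ?_
    · refine ((abs_le.1 (hupd S j z z)).2).trans ?_
      simp only [Pi.add_apply]
      gcongr
      -- The diagonal term `β z z` is not controlled by the averaged sensitivity; it costs `M`,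
      -- which is later absorbed as a lower-order term.
      exact (abs_le.1 (hM z z)).2
    · rw [integral_div]
      simp only [Pi.add_apply]
      rw [integral_add i6 (integrable_const _)]
      simp only [integral_const, probReal_univ, one_smul]
      gcongr
      exact integral_le_avgSensitivity hM _
  unfold defect
  rw [integral_sub i2 ((integrable_finsetSum _ fun j _ => i1 j).div_const _), integral_div,
    integral_finsetSum _ fun j _ => i1 j, ← sub_nonneg]
  have hs := Finset.sum_le_sum fun (j : Fin m) (_ : j ∈ Finset.univ) => hj j
  rw [Finset.sum_sub_distrib] at hs
  simp only [Finset.sum_const, Finset.card_univ, Fintype.card_fin, nsmul_eq_mul] at hs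
  rw [mul_div_cancel₀ _ hm'.ne'] at hs
  have : (avgSensitivity D β + M) / m - ((∫ S, ∫ z, l (A m S) z ∂D ∂P) -
      (∑ j : Fin m, ∫ S, l (A m S) (S j) ∂P) / m) =
      ((avgSensitivity D β + M) - (m * (∫ S, ∫ z, l (A m S) z ∂D ∂P) -
      (∑ j : Fin m, ∫ S, l (A m S) (S j) ∂P))) / m := by
    field_simp
  rw [this]
  exact div_nonneg (by linarith) hm'.le

/-- Stability bounds the increment of the generalization gap under replacement of one example. -/
theorem abs_defect_sub_update_le (hmeas : Measurable fun p : (Fin m → Z) × Z => l (A m p.1) p.2)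
    (hl : ∀ f z, 0 ≤ l f z ∧ l f z ≤ Ml) (hβ : Measurable (Function.uncurry β))
    (hM : ∀ z' z, |β z' z| ≤ M)
    (hupd : ∀ S j w z, |l (A m S) z - l (A m (Function.update S j w)) z| ≤ (β (S j) z + β w z) / m)
    (S : Fin m → Z) (k : Fin m) (w : Z) :
    |defect D A l m S - defect D A l m (Function.update S k w)| ≤
      (2 * avgSensitivity D β + Ml +
        (∑ j, if j = k then 0 else β (S k) (S j) + β w (S j)) / m) / m := by
  have hm' : (0 : ℝ) < m := by exact_mod_cast k.pos
  set S' := Function.update S k w with hS'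
  have i : ∀ S : Fin m → Z, Integrable (l (A m S)) D := fun S =>
    integrable_of_abs_le (hmeas.comp measurable_prodMk_left) (abs_loss_le hl _)
  have iβ : ∀ x, Integrable (β x) D := fun x =>
    integrable_of_abs_le (hβ.comp measurable_prodMk_left) (hM _)
  have e1 : |(∫ z, l (A m S) z ∂D) - ∫ z, l (A m S') z ∂D| ≤ 2 * avgSensitivity D β / m := by
    rw [← integral_sub (i S) (i S')]
    refine abs_integral_le_integral_abs.trans ((integral_mono ((i S).sub (i S')).abs
      (((iβ (S k)).add (iβ w)).div_const (m : ℝ)) fun z => hupd S k w z).trans ?_)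
    rw [integral_div]
    simp only [Pi.add_apply]
    rw [integral_add (iβ _) (iβ _)]
    gcongr
    linarith [integral_le_avgSensitivity (D := D) hM (S k), integral_le_avgSensitivity (D := D) hM w]
  have e2 : |(∑ j : Fin m, l (A m S) (S j)) - ∑ j : Fin m, l (A m S') (S' j)| ≤
      Ml + (∑ j, if j = k then 0 else β (S k) (S j) + β w (S j)) / m := by
    rw [← Finset.sum_sub_distrib, Finset.sum_div]
    have : Ml + ∑ j, (if j = k then 0 else β (S k) (S j) + β w (S j)) / (m : ℝ) =
        ∑ j, ((if j = k then Ml else 0) +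
          (if j = k then 0 else β (S k) (S j) + β w (S j)) / (m : ℝ)) := by
      rw [Finset.sum_add_distrib]
      simp
    rw [this]
    refine (Finset.abs_sum_le_sum_abs _ _).trans (Finset.sum_le_sum fun j _ => ?_)
    -- At the replaced index the two losses are evaluated at different points, so only their range
    -- `[0, Ml]` is available; elsewhere stability applies.
    by_cases h : j = k
    · simp only [h, if_true, zero_div, add_zero, abs_le]
      constructor <;> linarith [(hl (A m S) (S k)).1, (hl (A m S) (S k)).2,
        (hl (A m S') (S' k)).1, (hl (A m S') (S' k)).2]
    · simp only [h, if_false, zero_add]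
      rw [show S' j = S j by simp [hS', h]]
      exact hupd S k w (S j)
  have e3 : defect D A l m S - defect D A l m S' =
      ((∫ z, l (A m S) z ∂D) - ∫ z, l (A m S') z ∂D) -
      ((∑ j : Fin m, l (A m S) (S j)) - ∑ j : Fin m, l (A m S') (S' j)) / m := by
    unfold defect
    ring
  rw [e3]
  refine (abs_sub _ _).trans ?_
  rw [abs_div, abs_of_pos hm', add_assoc, add_div (2 * _)]
  gcongr

/-- Two copies of the averaged sensitivity come from the population risk; the other two come from
replacing the empirical averages of `β (S k)` and `β w` by their means, at the price of the
deviations. -/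
theorem abs_defect_sub_update_le_dev
    (hmeas : Measurable fun p : (Fin m → Z) × Z => l (A m p.1) p.2)
    (hl : ∀ f z, 0 ≤ l f z ∧ l f z ≤ Ml) (hβ : Measurable (Function.uncurry β))
    (hM : ∀ z' z, |β z' z| ≤ M) (h0 : ∀ z' z, 0 ≤ β z' z)
    (hupd : ∀ S j w z, |l (A m S) z - l (A m (Function.update S j w)) z| ≤ (β (S j) z + β w z) / m)
    (S : Fin m → Z) (k : Fin m) (w : Z) :
    |defect D A l m S - defect D A l m (Function.update S k w)| ≤
      (4 * avgSensitivity D β + Ml +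
        (leaveOneOutDev D (β (S k)) k S + leaveOneOutDev D (β w) k S)) / m := by
  have hm' : (0 : ℝ) < m := by exact_mod_cast k.pos
  refine (abs_defect_sub_update_le hmeas hl hβ hM hupd S k w).trans ?_
  have h : ∀ x, (∑ j, if j = k then 0 else β x (S j)) / (m : ℝ) ≤
      avgSensitivity D β + leaveOneOutDev D (β x) k S := by
    intro x
    refine le_trans ?_ (add_le_add_left (integral_le_avgSensitivity (D := D) hM x) _)
    rw [leaveOneOutDev, ← sub_le_iff_le_add, ← sub_div, ← Finset.sum_sub_distrib, div_le_iff₀ hm']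
    -- Only `m - 1` indices contribute a mean; its nonnegativity allows counting all `m`.
    have hc : 0 ≤ ∫ z, β x z ∂D := integral_nonneg (h0 x)
    have := Finset.sum_le_sum (s := Finset.univ)
      (f := fun j : Fin m => (if j = k then 0 else β x (S j)) -
        (if j = k then 0 else β x (S j) - ∫ z, β x z ∂D)) (g := fun _ => ∫ z, β x z ∂D)
      fun j _ => by by_cases h : j = k <;> simp [h, hc]
    refine this.trans (le_of_eq ?_)
    simp [mul_comm]
  have hsum : (∑ j, if j = k then 0 else β (S k) (S j) + β w (S j)) / (m : ℝ) =
      (∑ j, if j = k then 0 else β (S k) (S j)) / (m : ℝ) +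
      (∑ j, if j = k then 0 else β w (S j)) / (m : ℝ) := by
    rw [← add_div, ← Finset.sum_add_distrib]
    congr 1
    exact Finset.sum_congr rfl fun j _ => by by_cases h : j = k <;> simp [h]
  rw [hsum]
  refine div_le_div_of_nonneg_right ?_ hm'.le
  linarith [h (S k), h w]

theorem abs_defect_sub_update_le_const [Nonempty Z]
    (hmeas : Measurable fun p : (Fin m → Z) × Z => l (A m p.1) p.2)
    (hl : ∀ f z, 0 ≤ l f z ∧ l f z ≤ Ml) (hβ : Measurable (Function.uncurry β))
    (hM : ∀ z' z, |β z' z| ≤ M)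
    (hupd : ∀ S j w z, |l (A m S) z - l (A m (Function.update S j w)) z| ≤ (β (S j) z + β w z) / m)
    (S : Fin m → Z) (k : Fin m) (w : Z) :
    |defect D A l m S - defect D A l m (Function.update S k w)| ≤ (4 * M + Ml) / m := by
  have hm' : (0 : ℝ) < m := by exact_mod_cast k.pos
  refine (abs_defect_sub_update_le hmeas hl hβ hM hupd S k w).trans ?_
  have hσ : avgSensitivity D β ≤ M := avgSensitivity_le hM
  have hM0 : 0 ≤ M := (abs_nonneg _).trans (hM w w)
  have : (∑ j, if j = k then 0 else β (S k) (S j) + β w (S j)) / (m : ℝ) ≤ 2 * M := by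
    rw [div_le_iff₀' hm']
    have := Finset.sum_le_sum (s := Finset.univ)
      (f := fun j : Fin m => if j = k then 0 else β (S k) (S j) + β w (S j)) (g := fun _ => 2 * M)
      fun j _ => by
        by_cases h : j = k
        · simpa [h] using hM0
        · simp only [h, if_false]
          linarith [(abs_le.1 (hM (S k) (S j))).2, (abs_le.1 (hM w (S j))).2]
    simpa using this
  refine div_le_div_of_nonneg_right ?_ hm'.le
  linarith

/-- A Chebyshev-type argument: the excess is positive only when `y` exceeds the margin `τ`, and
there `x² ≤ B² ≤ B² y²/τ²`. -/
theorem max_sq_sub_sq_le {x b c B y τ : ℝ} (hτ : 0 < τ) (hB : |x| ≤ B)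
    (h : |x| ≤ c + y) (hb : b = c + τ) : max (x ^ 2 - b ^ 2) 0 ≤ B ^ 2 / τ ^ 2 * y ^ 2 := by
  refine max_le ?_ (by positivity)
  have hxx := sq_abs x
  have hx0 := abs_nonneg x
  by_cases hx : |x| ≤ b
  · have : x ^ 2 ≤ b ^ 2 := by rw [← hxx]; exact pow_le_pow_left₀ hx0 hx 2
    have : 0 ≤ B ^ 2 / τ ^ 2 * y ^ 2 := by positivity
    linarith
  · have hy : τ ≤ y := by linarith
    have h1 : x ^ 2 ≤ B ^ 2 := by rw [← hxx]; exact pow_le_pow_left₀ hx0 hB 2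
    have h2 : τ ^ 2 ≤ y ^ 2 := pow_le_pow_left₀ hτ.le hy 2
    have h3 : B ^ 2 ≤ B ^ 2 / τ ^ 2 * y ^ 2 := by
      rw [div_mul_eq_mul_div, le_div_iff₀ (by positivity)]
      exact mul_le_mul_of_nonneg_left h2 (sq_nonneg _)
    linarith [sq_nonneg b]

theorem measurable_leaveOneOutDev_param (hβ : Measurable (Function.uncurry β)) (k : Fin m) :
    Measurable fun p : Z × (Fin m → Z) => leaveOneOutDev D (β p.1) k p.2 := by
  unfold leaveOneOutDev
  refine (Finset.measurable_sum _ fun j _ => ?_).div_const _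
  by_cases h : j = k
  · simp only [h, if_true]
    exact measurable_const
  · simp only [h, if_false]
    exact (hβ.comp (f := fun p : Z × (Fin m → Z) => (p.1, p.2 j)) (by fun_prop)).sub
      ((Measurable.integral_right hβ).comp measurable_fst)

theorem abs_leaveOneOutDev_le {g : Z → ℝ} (hg : Measurable g) (h0 : ∀ z, 0 ≤ g z)
    (hM : ∀ z, g z ≤ M) (k : Fin m) (S : Fin m → Z) : |leaveOneOutDev D g k S| ≤ M := by
  have hm' : (0 : ℝ) < m := by exact_mod_cast k.pos
  have hc0 : 0 ≤ ∫ z, g z ∂D := integral_nonneg h0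
  have hcM : ∫ z, g z ∂D ≤ M := integral_le_of_le (integrable_of_abs_le hg fun z => by
    rw [abs_of_nonneg (h0 z)]; exact hM z) hM
  rw [leaveOneOutDev, abs_div, abs_of_pos hm', div_le_iff₀' hm']
  refine (Finset.abs_sum_le_sum_abs _ _).trans ?_
  have := Finset.sum_le_sum (s := Finset.univ)
    (f := fun j : Fin m => |if j = k then 0 else g (S j) - ∫ z, g z ∂D|) (g := fun _ => M)
    fun j _ => by
      by_cases h : j = k
      · simpa [h] using hc0.trans hcM
      · simp only [h, if_false, abs_le]
        constructor <;> linarith [h0 (S j), hM (S j)]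
  simpa using this

theorem max_sq_defect_sub_update_le [Nonempty Z]
    (hmeas : Measurable fun p : (Fin m → Z) × Z => l (A m p.1) p.2)
    (hl : ∀ f z, 0 ≤ l f z ∧ l f z ≤ Ml) (hβ : Measurable (Function.uncurry β))
    (hM : ∀ z' z, |β z' z| ≤ M) (h0 : ∀ z' z, 0 ≤ β z' z)
    (hupd : ∀ S j w z, |l (A m S) z - l (A m (Function.update S j w)) z| ≤ (β (S j) z + β w z) / m)
    (S : Fin m → Z) (k : Fin m) (w : Z) {τ : ℝ} (hτ : 0 < τ) :
    max ((defect D A l m S - defect D A l m (Function.update S k w)) ^ 2 -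
      ((4 * avgSensitivity D β + Ml + τ) / m) ^ 2) 0 ≤
      (4 * M + Ml) ^ 2 / τ ^ 2 / (m : ℝ) ^ 2 * (2 * leaveOneOutDev D (β (S k)) k S ^ 2 +
        2 * leaveOneOutDev D (β w) k S ^ 2) := by
  have hm' : (0 : ℝ) < m := by exact_mod_cast k.pos
  set y₁ := leaveOneOutDev D (β (S k)) k S with hy₁
  set y₂ := leaveOneOutDev D (β w) k S with hy₂
  have hdev := abs_defect_sub_update_le_dev (D := D) hmeas hl hβ hM h0 hupd S k w
  have hconst := abs_defect_sub_update_le_const (D := D) hmeas hl hβ hM hupd S k w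
  rw [← hy₁, ← hy₂, add_div] at hdev
  refine (max_sq_sub_sq_le (div_pos hτ hm') hconst hdev (add_div _ _ _)).trans ?_
  have : ((4 * M + Ml) / m) ^ 2 / (τ / m) ^ 2 * ((y₁ + y₂) / m) ^ 2 =
      (4 * M + Ml) ^ 2 / τ ^ 2 / (m : ℝ) ^ 2 * (y₁ + y₂) ^ 2 := by
    field_simp
  rw [this]
  exact mul_le_mul_of_nonneg_left (by nlinarith [sq_nonneg (y₁ - y₂)]) (by positivity)

/-- On average, the squared increments of the generalization gap under replacement of one example
exceed the typical value by very little. -/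
theorem integral_defect_excess_le [Nonempty Z]
    (hmeas : Measurable fun p : (Fin m → Z) × Z => l (A m p.1) p.2)
    (hl : ∀ f z, 0 ≤ l f z ∧ l f z ≤ Ml) (hβ : Measurable (Function.uncurry β))
    (hM : ∀ z' z, |β z' z| ≤ M) (h0 : ∀ z' z, 0 ≤ β z' z)
    (hupd : ∀ S j w z, |l (A m S) z - l (A m (Function.update S j w)) z| ≤ (β (S j) z + β w z) / m)
    (k : Fin m) {τ : ℝ} (hτ : 0 < τ) :
    ∫ S, ∫ w, max ((defect D A l m S - defect D A l m (Function.update S k w)) ^ 2 -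
      ((4 * avgSensitivity D β + Ml + τ) / m) ^ 2) 0 ∂D ∂Measure.pi (fun _ : Fin m => D) ≤
      (4 * M + Ml) ^ 2 / τ ^ 2 * (4 * M ^ 2) / m ^ 3 := by
  have hm' : (0 : ℝ) < m := by exact_mod_cast k.pos
  set P := Measure.pi (fun _ : Fin m => D) with hP
  set Y : Z → (Fin m → Z) → ℝ := fun x S => leaveOneOutDev D (β x) k S with hY
  have hYm : Measurable fun p : Z × (Fin m → Z) => Y p.1 p.2 := measurable_leaveOneOutDev_param hβ k
  have hYK : ∀ x S, |Y x S| ≤ M := fun x S =>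
    abs_leaveOneOutDev_le (hβ.comp measurable_prodMk_left) (h0 x)
      (fun z => (abs_le.1 (hM x z)).2) k S
  have hYK2 : ∀ x S, |Y x S ^ 2| ≤ M ^ 2 := fun x S => by
    rw [abs_pow]; exact pow_le_pow_left₀ (abs_nonneg _) (hYK x S) 2
  have hY2 : ∀ x, ∫ S, Y x S ^ 2 ∂P ≤ M ^ 2 / m := fun x =>
    integral_sq_leaveOneOutDev_le D (hβ.comp measurable_prodMk_left) (h0 x)
      (fun z => (abs_le.1 (hM x z)).2) k
  have hYw : ∫ S, ∫ w, Y w S ^ 2 ∂D ∂P ≤ M ^ 2 / m := by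
    have i : Integrable (Function.uncurry fun (w : Z) (S : Fin m → Z) => Y w S ^ 2) (D.prod P) :=
      integrable_of_abs_le (hYm.pow_const 2) fun p => hYK2 _ _
    rw [← integral_integral_swap i]
    exact integral_le_of_le i.integral_prod_left hY2
  -- The deviation ignores coordinate `k` of its sample, so `S k` can be replaced by an independent
  -- `w`, which reduces to `hYw`.
  have hYS : ∫ S, Y (S k) S ^ 2 ∂P ≤ M ^ 2 / m := by
    refine le_trans (le_of_eq ?_) hYw
    rw [← integral_pi_update D k (f := fun S => Y (S k) S ^ 2) ((hYm.comp
      (f := fun S : Fin m → Z => (S k, S)) (by fun_prop)).pow_const 2) fun S => hYK2 _ _]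
    simp only [hY, Function.update_self, leaveOneOutDev_update]
    rfl
  set C := (4 * M + Ml) ^ 2 / τ ^ 2 / (m : ℝ) ^ 2 with hC
  have hC0 : 0 ≤ C := by positivity
  have hYSm : Measurable fun S : Fin m → Z => Y (S k) S :=
    hYm.comp (f := fun S : Fin m → Z => (S k, S)) (by fun_prop)
  have iS : Integrable (fun S : Fin m → Z => Y (S k) S ^ 2) P :=
    integrable_of_abs_le (hYSm.pow_const 2) fun S => hYK2 _ _
  have iwm : Measurable (Function.uncurry fun (S : Fin m → Z) w => Y w S ^ 2) :=
    (hYm.comp (f := fun p : (Fin m → Z) × Z => (p.2, p.1)) (by fun_prop)).pow_const 2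
  have iw : ∀ S, Integrable (fun w => Y w S ^ 2) D := fun S =>
    integrable_of_abs_le ((hYm.comp (f := fun w => (w, S)) (by fun_prop)).pow_const 2)
      fun w => hYK2 _ _
  have iSw : Integrable (fun S : Fin m → Z => ∫ w, Y w S ^ 2 ∂D) P :=
    integrable_of_abs_le (Measurable.integral_right iwm) fun S =>
      abs_integral_le_of_abs_le fun w => hYK2 _ _
  have hpt : ∀ S w, max ((defect D A l m S - defect D A l m (Function.update S k w)) ^ 2 -
      ((4 * avgSensitivity D β + Ml + τ) / m) ^ 2) 0 ≤ C * (2 * Y (S k) S ^ 2 + 2 * Y w S ^ 2) :=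
    fun S w => max_sq_defect_sub_update_le hmeas hl hβ hM h0 hupd S k w hτ
  have hin : ∀ S, ∫ w, max ((defect D A l m S - defect D A l m (Function.update S k w)) ^ 2 -
      ((4 * avgSensitivity D β + Ml + τ) / m) ^ 2) 0 ∂D ≤
      C * (2 * Y (S k) S ^ 2 + 2 * ∫ w, Y w S ^ 2 ∂D) := by
    intro S
    refine (integral_mono_of_nonneg (ae_of_all _ fun w => le_max_right _ _)
      (((integrable_const _).add ((iw S).const_mul 2)).const_mul C)
      (ae_of_all _ (hpt S))).trans_eq ?_
    simp only [Pi.add_apply]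
    rw [integral_const_mul, integral_add (integrable_const _) ((iw S).const_mul 2),
      integral_const_mul 2 fun w => Y w S ^ 2]
    simp
  refine (integral_mono_of_nonneg (ae_of_all _ fun S => integral_nonneg fun w => le_max_right _ _)
    (((iS.const_mul 2).add (iSw.const_mul 2)).const_mul C) (ae_of_all _ hin)).trans ?_
  simp only [Pi.add_apply]
  rw [integral_const_mul, integral_add (iS.const_mul 2) (iSw.const_mul 2), integral_const_mul,
    integral_const_mul]
  have hfin : (4 * M + Ml) ^ 2 / τ ^ 2 * (4 * M ^ 2) / m ^ 3 =
      C * (2 * (M ^ 2 / m) + 2 * (M ^ 2 / m)) := by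
    rw [hC]
    field_simp
    ring
  rw [hfin]
  gcongr

end Defect

/-! ### Limits, choice of the sample size, and the tail bound -/

theorem tendsto_sqrt_const_div_nat (a : ℝ) :
    Tendsto (fun m : ℕ => Real.sqrt (a / m)) atTop (𝓝 0) := by
  have h := (Real.continuous_sqrt.tendsto 0).comp (tendsto_const_div_atTop_nhds_zero_nat a)
  rwa [Real.sqrt_zero] at h

theorem tendsto_defectBound (σ η Ml δ : ℝ) :
    Tendsto (fun m : ℕ => defectBound σ η Ml δ m) atTop (𝓝 0) := by
  simpa [defectBound] using (tendsto_const_div_atTop_nhds_zero_nat (2 * σ)).add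
    ((tendsto_sqrt_const_div_nat (2 * Real.log (2 / δ))).const_mul (2 * (2 * σ + η + Ml)))

/-- For large `m` the lower-order terms in the tail estimate are negligible. -/
theorem exists_sample_size (M Ml : ℝ) {η δ ℓ : ℝ} (hη : 0 < η) (hδ : 0 < δ) (hℓ : 0 < ℓ) :
    ∃ m₀ : ℕ, ∀ m : ℕ, m₀ ≤ m → 2 ≤ m ∧ Real.sqrt (2 * ℓ / m) * (4 * M + Ml) ≤ η ∧
      4 * ((4 * M + Ml) ^ 2 / (η / 2) ^ 2 * (4 * M ^ 2)) / η ^ 2 / m ≤ δ / 2 ∧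
      M / m ≤ η * Real.sqrt (2 * ℓ / m) := by
  -- The three conditions serve, in order, `t * B ≤ 1`, the probability of the exceptional event,
  -- and the absorption of `M/m`. None involves the averaged sensitivity, so the threshold is
  -- uniform in the distribution.
  have h1 : ∀ᶠ m : ℕ in atTop, Real.sqrt (2 * ℓ / m) * (4 * M + Ml) ≤ η := by
    have := (tendsto_sqrt_const_div_nat (2 * ℓ)).mul_const (4 * M + Ml)
    rw [zero_mul] at this
    exact this.eventually_le_const hη
  have h2 := (tendsto_const_div_atTop_nhds_zero_nat
    (4 * ((4 * M + Ml) ^ 2 / (η / 2) ^ 2 * (4 * M ^ 2)) / η ^ 2)).eventually_le_const (half_pos hδ)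
  have h3 : ∀ᶠ m : ℕ in atTop, (M / η) ^ 2 / (2 * ℓ) ≤ m :=
    tendsto_natCast_atTop_atTop.eventually_ge_atTop _
  obtain ⟨m₀, h⟩ := eventually_atTop.1 (((eventually_ge_atTop 2).and h1).and (h2.and h3))
  refine ⟨m₀, fun m hm => ?_⟩
  obtain ⟨⟨a2, a1⟩, a3, a4⟩ := h m hm
  refine ⟨a2, a1, a3, ?_⟩
  have hm' : (0 : ℝ) < m := by exact_mod_cast (by omega : 0 < m)
  have h5 : M / η / m ≤ Real.sqrt (2 * ℓ / m) := by
    refine Real.le_sqrt_of_sq_le ?_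
    rw [div_le_iff₀ (by positivity)] at a4
    rw [div_pow, div_le_div_iff₀ (by positivity) hm']
    nlinarith
  have h6 := mul_le_mul_of_nonneg_left h5 hη.le
  have h7 : η * (M / η / m) = M / m := by field_simp
  rwa [h7] at h6

/-- The tail of the generalization gap beyond the bound, for one sample size. -/
theorem measureReal_defectBound_lt_le {Z F : Type*} [MeasurableSpace Z] [Nonempty Z] {D : Measure Z}
    [IsProbabilityMeasure D] {A : LearningAlgorithm Z F} {l : F → Z → ℝ} {β : Z → Z → ℝ} {m : ℕ}
    {Ml M η δ : ℝ} (hmeas : Measurable fun p : (Fin m → Z) × Z => l (A m p.1) p.2)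
    (hl : ∀ f z, 0 ≤ l f z ∧ l f z ≤ Ml) (hβ : Measurable (Function.uncurry β))
    (hM : ∀ z' z, |β z' z| ≤ M) (h0 : ∀ z' z, 0 ≤ β z' z)
    (hupd : ∀ S j w z, |l (A m S) z - l (A m (Function.update S j w)) z| ≤ (β (S j) z + β w z) / m)
    (hη : 0 < η) (hδ0 : 0 < δ) (hδ1 : δ < 1) (hm : 2 ≤ m)
    (h1 : Real.sqrt (2 * Real.log (2 / δ) / m) * (4 * M + Ml) ≤ η)
    (h2 : 4 * ((4 * M + Ml) ^ 2 / (η / 2) ^ 2 * (4 * M ^ 2)) / η ^ 2 / m ≤ δ / 2)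
    (h3 : M / m ≤ η * Real.sqrt (2 * Real.log (2 / δ) / m)) :
    (Measure.pi (fun _ : Fin m => D)).real
      {S | defectBound (avgSensitivity D β) η Ml δ m < defect D A l m S} ≤ δ := by
  have hm' : (0 : ℝ) < m := by exact_mod_cast (by omega : 0 < m)
  set σ := avgSensitivity D β with hσ
  set ℓ := Real.log (2 / δ) with hℓ
  set r := Real.sqrt (2 * ℓ / m) with hr
  have hℓ0 : 0 < ℓ := Real.log_pos (by rw [lt_div_iff₀ hδ0]; linarith)
  have hr0 : 0 ≤ r := Real.sqrt_nonneg _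
  have hr2 : r ^ 2 = 2 * ℓ / m := Real.sq_sqrt (by positivity)
  have hσ0 : 0 ≤ σ := avgSensitivity_nonneg h0
  obtain ⟨z⟩ := ‹Nonempty Z›
  have : Nonempty Z := ⟨z⟩
  have hMl : 0 ≤ Ml := (hl (A m fun _ => z) z).1.trans (hl _ z).2
  -- This is the coefficient in `defectBound` minus `η`; the reserved `η * r` pays for the `M/m` in
  -- the mean.
  set C := 4 * σ + η + 2 * Ml with hC
  have hC0 : 0 < C := by positivity
  -- The margin in `b` is `τ = η/2`. The choice of `t` makes `t * u = m r² = 2ℓ`, and `s` is of the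
  -- same order `1/m` as `m b²`. Since `C ≥ η`, the hypothesis `h1` gives `t * B ≤ 1`.
  have hmain := measureReal_integral_add_lt_le D m (measurable_defect (D := D) hmeas)
    (abs_defect_le hmeas hl (by omega)) (abs_defect_sub_update_le_const hmeas hl hβ hM hupd)
    (b := (4 * σ + Ml + η / 2) / m) (t := m * r / C) (u := C * r) (s := η ^ 2 / 8 / m)
    (by positivity) (by
      have : m * r / C * ((4 * M + Ml) / m) = r * (4 * M + Ml) / C := by field_simp
      rw [this, div_le_one hC0]
      linarith) (by positivity)
  have hmean := integral_defect_le (D := D) hmeas hl (by omega) hβ hM hupd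
  rw [← hσ] at hmean
  have hsub : {S | defectBound σ η Ml δ m < defect D A l m S} ⊆
      {S | (∫ T, defect D A l m T ∂Measure.pi (fun _ : Fin m => D)) + C * r < defect D A l m S} := by
    intro S hS
    refine lt_of_le_of_lt ?_ (show defectBound σ η Ml δ m < defect D A l m S from hS)
    rw [defectBound, ← hℓ, ← hr]
    have e : (σ + M) / m = σ / m + M / m := add_div _ _ _
    have e' : 2 * σ / m = σ / m + σ / m := by ring
    have : 0 ≤ σ / m := by positivity
    rw [e] at hmean
    rw [e', hC]
    linarith
  refine (measureReal_mono hsub).trans (hmain.trans ?_)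
  have hexp : Real.exp ((m * r / C) ^ 2 * (m * (((4 * σ + Ml + η / 2) / m) ^ 2 / 2) +
      η ^ 2 / 8 / m) - m * r / C * (C * r)) ≤ δ / 2 := by
    have h4 : (m * r / C) ^ 2 * (m * (((4 * σ + Ml + η / 2) / m) ^ 2 / 2) +
        η ^ 2 / 8 / m) = m * r ^ 2 / 2 * (((4 * σ + Ml + η / 2) ^ 2 + η ^ 2 / 4) / C ^ 2) := by
      field_simp
      ring
    have h5 : m * r / C * (C * r) = m * r ^ 2 := by field_simp
    -- Hence the quadratic part of the exponent is at most `m r²/2 = ℓ`, and the whole exponent at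
    -- most `ℓ - 2ℓ = -ℓ`.
    have h6 : ((4 * σ + Ml + η / 2) ^ 2 + η ^ 2 / 4) / C ^ 2 ≤ 1 := by
      rw [div_le_one (by positivity), hC]
      nlinarith [mul_nonneg hσ0 hη.le, mul_nonneg hσ0 hMl, mul_nonneg hMl hη.le]
    have h7 : m * r ^ 2 = 2 * ℓ := by rw [hr2]; field_simp
    rw [h4, h5, h7]
    have h8 : Real.exp (-ℓ) = δ / 2 := by
      rw [Real.exp_neg, hℓ, Real.exp_log (by positivity), inv_div]
    rw [← h8, Real.exp_le_exp]
    nlinarith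
  have hexc : (∑ k, ∫ S, ∫ z, max ((defect D A l m S - defect D A l m (Function.update S k z)) ^ 2 -
      ((4 * σ + Ml + η / 2) / m) ^ 2) 0 ∂D ∂Measure.pi (fun _ : Fin m => D)) /
      (2 * (η ^ 2 / 8 / m)) ≤ δ / 2 := by
    -- There are `m` coordinates, each with excess of order `m⁻³`; division by `2s`, of order `1/m`,
    -- leaves order `1/m`.
    refine le_trans ?_ h2
    rw [div_le_iff₀ (by positivity)]
    refine (Finset.sum_le_sum fun k _ => integral_defect_excess_le hmeas hl hβ hM h0 hupd k
      (half_pos hη)).trans (le_of_eq ?_)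
    simp only [Finset.sum_const, Finset.card_univ, Fintype.card_fin, nsmul_eq_mul]
    field_simp
    ring
  linarith

theorem theorem3p1 (d : ℕ) (L : ℝ≥0) (Mβ Ml η δ : ℝ)
    (hMβ : 0 < Mβ) (hη : 0 < η) (hδ0 : 0 < δ) (hδ1 : δ < 1) :
    ∃ m₀ : ℕ,
      ∀ (Z : Set (EuclideanSpace ℝ (Fin d))), Bornology.IsBounded Z →
      ∀ (D : Measure Z) [IsProbabilityMeasure D]
        (F : Type*) (A : LearningAlgorithm Z F) (l : F → Z → ℝ)
        (βm : ℕ → Z → Z → ℝ) (β : Z → Z → ℝ),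
      (∀ n : ℕ, Measurable (fun p : (Fin n → Z) × Z => l (A n p.1) p.2)) →
      (∀ z' : Z, Measurable (β z')) →
      (∀ (f : F) (z : Z), 0 ≤ l f z ∧ l f z ≤ Ml) →
      LocallyElasticStable A l βm →
      (∀ m : ℕ, 2 ≤ m → ∀ z' z : Z, βm m z' z = β z' z / m) →
      (∀ z : Z, LipschitzWith L (fun z' : Z => β z' z)) →
      (∀ z' z : Z, |β z' z| ≤ Mβ) →
      (∀ m : ℕ, m₀ ≤ m →
        1 - δ ≤ (Measure.pi (fun _ : Fin m => D)).real
          {S : Fin m → Z | defect D A l m S ≤ defectBound (avgSensitivity D β) η Ml δ m}) ∧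
      Tendsto (fun m : ℕ => defectBound (avgSensitivity D β) η Ml δ m) atTop (𝓝 0) := by

  have hℓ : 0 < Real.log (2 / δ) := Real.log_pos (by rw [lt_div_iff₀ hδ0]; linarith)
  obtain ⟨m₀, hm₀⟩ := exists_sample_size Mβ Ml hη hδ0 hℓ
  refine ⟨m₀, fun Z _ D _ F A l βm β hmeas hβ hl hA hβm hLip hM =>
    ⟨fun m hm => ?_, tendsto_defectBound _ _ _ _⟩⟩
  obtain ⟨hm2, h1, h2, h3⟩ := hm₀ m hm
  have : Nonempty Z := nonempty_of_isProbabilityMeasure D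
  -- A Carathéodory function, continuous in one argument and measurable in the other, is jointly
  -- measurable; this is where the Lipschitz condition enters.
  have hβ' : Measurable (Function.uncurry β) :=
    measurable_uncurry_of_continuous_of_measurable (fun z => (hLip z).continuous) hβ
  -- Stability at the single size `m = 2` already forces `β/2` to dominate an absolute value.
  have h0 : ∀ z' z, 0 ≤ β z' z := fun z' z => by
    have h := hA.nonneg le_rfl z' z
    rw [hβm 2 le_rfl] at h
    push_cast at h
    linarith
  have hupd : ∀ S j w z, |l (A m S) z - l (A m (Function.update S j w)) z| ≤
      (β (S j) z + β w z) / m := fun S j w z => by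
    rw [add_div, ← hβm m hm2, ← hβm m hm2]
    exact hA.abs_sub_update_le hm2 S j w z
  have hbad := measureReal_defectBound_lt_le (D := D) (hmeas m) hl hβ' hM h0 hupd hη hδ0 hδ1 hm2
    h1 h2 h3
  have hgood : MeasurableSet {S : Fin m → Z | defect D A l m S ≤
      defectBound (avgSensitivity D β) η Ml δ m} :=
    measurableSet_le (measurable_defect (hmeas m)) measurable_const
  have hcompl := probReal_compl_eq_one_sub (μ := Measure.pi (fun _ : Fin m => D)) hgood
  rw [show {S : Fin m → Z | defect D A l m S ≤ defectBound (avgSensitivity D β) η Ml δ m}ᶜ =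
    {S | defectBound (avgSensitivity D β) η Ml δ m < defect D A l m S} by
      ext S; simp] at hcompl
  linarith
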